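/- A teacher transfer problem consists of finite sets $S$ (surplus schools), $D$ (deficit schools) and $T$ (teachers), positive integers $\alpha_s$ $(s\in S)$ and $\beta_d$ $(d\in D)$, an initial assignment $O:T\to S$, and for each $t\in T$ a nonempty set $A(t)\subseteq D$ of acceptable deficit schools. The associated network has an edge $(N_0,s)$ for each $s\in S$ (with $N_0$ a source node), an edge $(O(t),t)$ for each $t\in T$, and an edge $(t,d)$ for each $t\in T$ and $d\in A(t)$. A flow is a map $f\ge 0$ from the edges to the reals such that $f(N_0,s)=\sum_{t:\,O(t)=s}f(s,t)\le\alpha_s$ for all $s\in S$; $f(O(t),t)=\sum_{d\in A(t)}f(t,d)\le 1$ for all $t\in T$; $f(t,d)\le 1$ for every edge $(t,d)$; and $f(d):=\sum_{t:\,d\in A(t)}f(t,d)\le\beta_d$ for all $d\in D$. For $x\in\mathbb R^D$ and $B\subseteq D$ write $x(B)=\sum_{d\in B}x_d$. Let $v(B)$ be the maximum of $\sum_{d\in B}f(d)$ over all flows $f$, and let $w(B)=\beta(B)-v(B)$. A vector $h\in\mathbb R^D$ is achievable if there is a flow $f$ with $h_d=\beta_d-f(d)$ for all $d\in D$. The Megiddo–Dutta–Ray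 (MDR) algorithm starts with $\overline D_0=\emptyset$. As long as $\overline D_{j-1}\neq D$, it chooses a set $D_j$ that maximizes $$\frac{w(B\cup\overline D_{j-1})-w(\overline D_{j-1})}{|B|}$$ over all nonempty $B\subseteq D\setminus\overline D_{j-1}$, with ties broken arbitrarily, and puts $\overline D_j=\overline D_{j-1}\cup D_j$. It stops with a partition $(D_1,\dots,D_{k^\star})$ of $D$ and returns the vector $h^\star$ given by $$h^\star_d=\frac{w(\overline D_j)-w(\overline D_{j-1})}{|D_j|}\qquad\text{for } d\in D_j .$$ **Proposition (Rounding).** For every teacher transfer problem the MDR algorithm has an output, and for every possible output $(D_1,\dots,D_{k^\star})$, $h^\star$ (that is, for every resolution of ties) there is an MDR-consistent deficit vector: an achievable vector $h\in\mathbb R^D$ with integer entries such that $h_d\in\{\lfloor h^\star_d\rfloor,\lceil h^\star_d\rceil\}$ for all $d\in D$ and $h(\overline D_j)=w(\overline D_j)$ for all $j\in\{1,\dots,k^\star\}$. -/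

import Mathlib

/-- A teacher transfer problem: finite sets of surplus schools `S`, deficit schools `D` and
teachers `T`, with surpluses `α`, deficits `β`, initial assignment `O` and acceptable sets `A`. -/
structure TransferProblem (S D T : Type*) [Fintype S] [Fintype D] [Fintype T] where
  /-- surplus of a surplus school -/
  α : S → ℕ
  /-- deficit of a deficit school -/
  β : D → ℕ
  α_pos : ∀ s, 0 < α s
  β_pos : ∀ d, 0 < β d
  /-- initial assignment of a teacher -/
  O : T → S
  /-- acceptable deficit schools of a teacher -/
  A : T → Finset D
  A_nonempty : ∀ t, (A t).Nonempty

namespace TransferProblem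

/-- Edges of the network: `(N₀, s)` for a surplus school `s`, `(O t, t)` for a teacher `t`,
and `(t, d)` for a teacher `t` and an acceptable deficit school `d ∈ A t`. -/
inductive Edge {S D T : Type*} [Fintype S] [Fintype D] [Fintype T]
    (G : TransferProblem S D T) where
  | source (s : S) : Edge G
  | assign (t : T) : Edge G
  | move (t : T) (d : D) (h : d ∈ G.A t) : Edge G

noncomputable section

variable {S D T : Type*} [Fintype S] [Fintype D] [Fintype T]

open scoped Classical in
/-- The flow `f(d)` into the sink `d`, the sum over the edges `(t, d)` with `d ∈ A t`. -/
def inflow (G : TransferProblem S D T) (f : G.Edge → ℝ) (d : D) : ℝ :=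
  ∑ t : {t : T // d ∈ G.A t}, f (.move t.1 d t.2)

open scoped Classical in
/-- A (real-valued) feasible flow in the network. -/
structure IsFlow (G : TransferProblem S D T) (f : G.Edge → ℝ) : Prop where
  nonneg : ∀ e, 0 ≤ f e
  balance_school : ∀ s, f (.source s) = ∑ t : T with G.O t = s, f (.assign t)
  balance_teacher : ∀ t, f (.assign t) = ∑ d : {d : D // d ∈ G.A t}, f (.move t d.1 d.2)
  cap_source : ∀ s, f (.source s) ≤ G.α s
  cap_assign : ∀ t, f (.assign t) ≤ 1
  cap_move : ∀ t d (h : d ∈ G.A t), f (.move t d h) ≤ 1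
  cap_sink : ∀ d, G.inflow f d ≤ G.β d

/-- `v(B)`: the maximum total flow into the sinks in `B`, over all feasible flows. -/
def v (G : TransferProblem S D T) (B : Finset D) : ℝ :=
  sSup {x : ℝ | ∃ f : G.Edge → ℝ, G.IsFlow f ∧ x = ∑ d ∈ B, G.inflow f d}

/-- The supremum defining `v` is taken over a nonempty set that is bounded above. -/
theorem v_set_nonempty_bddAbove (G : TransferProblem S D T) (B : Finset D) :
    {x : ℝ | ∃ f : G.Edge → ℝ, G.IsFlow f ∧ x = ∑ d ∈ B, G.inflow f d}.Nonempty ∧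
    BddAbove {x : ℝ | ∃ f : G.Edge → ℝ, G.IsFlow f ∧ x = ∑ d ∈ B, G.inflow f d} := by
  constructor
  · exact ⟨_, fun _ => 0, by constructor <;> simp [inflow], rfl⟩
  · refine ⟨∑ d ∈ B, (G.β d : ℝ), ?_⟩
    rintro x ⟨f, hf, rfl⟩
    exact Finset.sum_le_sum fun d _ => hf.cap_sink d

/-- The characteristic function `w(B) = β(B) - v(B)`. -/
def w (G : TransferProblem S D T) (B : Finset D) : ℝ :=
  ∑ d ∈ B, (G.β d : ℝ) - G.v B

/-- `h` is the vector of post-transfer deficits of some feasible flow. -/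
def Achievable (G : TransferProblem S D T) (h : D → ℝ) : Prop :=
  ∃ f : G.Edge → ℝ, G.IsFlow f ∧ ∀ d, h d = G.β d - G.inflow f d

open scoped Classical in
/-- The union of the first `m` sets of the sequence `P 0, P 1, …, P (k - 1)`. -/
def prefixUnion {k : ℕ} (P : Fin k → Finset D) (m : ℕ) : Finset D :=
  (Finset.univ.filter fun i : Fin k => (i : ℕ) < m).biUnion P

open scoped Classical in
/-- `B` is a nonempty subset of the complement of `C` that has the highest average marginal
contribution to `C` among all such sets. -/
def IsMDRChoice (G : TransferProblem S D T) (C B : Finset D) : Prop :=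
  B.Nonempty ∧ Disjoint B C ∧
    ∀ B' : Finset D, B'.Nonempty → Disjoint B' C →
      (G.w (B' ∪ C) - G.w C) / (B'.card : ℝ) ≤ (G.w (B ∪ C) - G.w C) / (B.card : ℝ)

/-- `P 0, …, P (k - 1)` are the sets chosen by a run of the MDR algorithm (with some resolution
of ties) until all of `D` is exhausted, and `hstar` is the deficit vector that it returns. -/
structure IsMDROutput (G : TransferProblem S D T) {k : ℕ} (P : Fin k → Finset D)
    (hstar : D → ℝ) : Prop where
  choice : ∀ j : Fin k, G.IsMDRChoice (prefixUnion P j) (P j)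
  exhaust : prefixUnion P k = Finset.univ
  value : ∀ j : Fin k, ∀ d ∈ P j,
    hstar d = (G.w (prefixUnion P ((j : ℕ) + 1)) - G.w (prefixUnion P j)) / ((P j).card : ℝ)

/-- `h` is an MDR-consistent deficit vector with respect to the MDR output `(P, hstar)`. -/
structure IsMDRConsistent (G : TransferProblem S D T) {k : ℕ} (P : Fin k → Finset D)
    (hstar h : D → ℝ) : Prop where
  integral : ∀ d, ∃ z : ℤ, h d = z
  achievable : G.Achievable h
  rounding : ∀ d, h d = ⌊hstar d⌋ ∨ h d = ⌈hstar d⌉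
  binding : ∀ j : Fin k,
    ∑ d ∈ prefixUnion P ((j : ℕ) + 1), h d = G.w (prefixUnion P ((j : ℕ) + 1))

end

end TransferProblem

/-! The function `w` is integer-valued and supermodular, and `hstar` lies in its core: `hstar(B) ≥
w(B)` for all `B`, with equality on every MDR prefix (`IsMDROutput.w_le_sum`,
`IsMDROutput.sum_prefixUnion`). The core vectors in the box between floor and ceiling of `hstar`
that keep its tight sets tight form a nonempty compact set; uncrossing tight sets shows that its
extreme points are integral (`exists_integral_rounding`). Integral core vectors are achievable by
Hall's theorem (`achievable_of_core`). The properties of `w` come from the min-max formula: `v(B)`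
is the minimum of `β(B \ C) + supply(C)` over `C ⊆ B`, attained by an integral flow since `supply`
is submodular (`exists_v_eq`). -/

/-! ### Integral vectors and super- or submodular functions -/

/-- A vector above an integer-valued supermodular function, with equal total, can be rounded to an
integral one such that all tight sets stay tight. -/
theorem exists_integral_rounding {D : Type*} [Fintype D] [DecidableEq D] (w : Finset D → ℝ)
    (hint : ∀ B, ∃ z : ℤ, w B = z) (hsup : ∀ A B, w A + w B ≤ w (A ∪ B) + w (A ∩ B))
    (x : D → ℝ) (hge : ∀ B, w B ≤ ∑ d ∈ B, x d) (htop : ∑ d, x d = w Finset.univ) :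
    ∃ h : D → ℝ, (∀ d, ∃ z : ℤ, h d = z) ∧ (∀ B, w B ≤ ∑ d ∈ B, h d) ∧
      (∀ d, h d = ⌊x d⌋ ∨ h d = ⌈x d⌉) ∧
      ∀ B, ∑ d ∈ B, x d = w B → ∑ d ∈ B, h d = w B := by
  set Q : Set (D → ℝ) := {h | (∀ d, h d ∈ Set.Icc (⌊x d⌋ : ℝ) ⌈x d⌉) ∧
    ∀ B, w B ≤ ∑ d ∈ B, h d ∧ (∑ d ∈ B, x d = w B → ∑ d ∈ B, h d = w B)} with hQ
  have hQc : IsCompact Q := by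
    refine IsCompact.of_isClosed_subset
      (isCompact_univ_pi fun d => isCompact_Icc (a := (⌊x d⌋ : ℝ)) (b := ⌈x d⌉)) ?_
      (fun h hh d _ => hh.1 d)
    simp only [hQ, Set.mem_Icc, Set.ofPred_and, Set.ofPred_forall]
    refine IsClosed.inter (isClosed_iInter fun d => ?_) (isClosed_iInter fun B => ?_)
    · exact (isClosed_le (by fun_prop) (by fun_prop)).inter
        (isClosed_le (by fun_prop) (by fun_prop))
    · refine (isClosed_le (by fun_prop) (by fun_prop)).inter (isClosed_iInter fun _ => ?_)
      exact isClosed_eq (by fun_prop) (by fun_prop)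
  have hQne : Q.Nonempty := ⟨x, fun d => ⟨Int.floor_le _, Int.le_ceil _⟩, fun B => ⟨hge B, id⟩⟩
  obtain ⟨h, hh⟩ := hQc.extremePoints_nonempty hQne
  have hhQ : h ∈ Q := hh.1
  have hinteg : ∀ d, ∃ z : ℤ, h d = z := by
    by_contra! hfrac
    obtain ⟨d₀, hd₀⟩ := hfrac
    classical
    -- Let `M` be a smallest tight set with a fractional coordinate. Tight sets are closed under
    -- intersection, so any tight set containing a fractional element of `M` contains all of `M`.
    obtain ⟨M, hM, hMmin⟩ := Finset.exists_min_image
      (Finset.univ.filter fun M : Finset D =>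
        ∑ d ∈ M, h d = w M ∧ ∃ d ∈ M, ∀ z : ℤ, h d ≠ z) Finset.card
      ⟨Finset.univ, by simpa using ⟨(hhQ.2 _).2 htop, d₀, hd₀⟩⟩
    simp only [Finset.mem_filter, Finset.mem_univ, true_and] at hM hMmin
    obtain ⟨hMt, d, hdM, hd⟩ := hM
    have hmem : ∀ a ∈ M, (∀ z : ℤ, h a ≠ z) → ∀ N, ∑ i ∈ N, h i = w N → a ∈ N → M ⊆ N := by
      intro a haM ha N hN haN
      have h1 := hsup M N
      have h2 := (hhQ.2 (M ∪ N)).1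
      have h3 := (hhQ.2 (M ∩ N)).1
      have h4 := Finset.sum_union_inter (s₁ := M) (s₂ := N) (f := h)
      have h5 := hMmin (M ∩ N) ⟨by linarith, a, by simp [haM, haN], ha⟩
      have h6 := Finset.eq_of_subset_of_card_le Finset.inter_subset_left h5
      exact Finset.inter_eq_left.1 h6
    -- The sum over `M` is the integer `w M`, so `d` cannot be its only fractional coordinate.
    obtain ⟨e, heM, hed, he⟩ : ∃ e ∈ M, e ≠ d ∧ ∀ z : ℤ, h e ≠ z := by
      by_contra! hcon
      choose! zf hzf using hcon
      obtain ⟨zw, hzw⟩ := hint M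
      refine hd (zw - ∑ a ∈ M.erase d, zf a) ?_
      have h1 := Finset.add_sum_erase M h hdM
      have h2 : ∑ a ∈ M.erase d, h a = ∑ a ∈ M.erase d, (zf a : ℝ) :=
        Finset.sum_congr rfl fun a ha =>
          hzf a (Finset.mem_of_mem_erase ha) (Finset.ne_of_mem_erase ha)
      push_cast
      linarith
    -- A tight set contains both or neither of `d` and `e`, so moving along `u` preserves tight
    -- sums. The box bounds at `d`, `e` and the constraints of non-tight sets are slack, so `h` is
    -- interior to a segment in `Q`.
    set u : D → ℝ := Pi.single d 1 - Pi.single e 1 with hu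
    have hev : ∀ᶠ ε : ℝ in nhds 0, h + ε • u ∈ Q := by
      have hsum : ∀ (B : Finset D) (ε : ℝ), ∑ a ∈ B, (h + ε • u) a =
          ∑ a ∈ B, h a + ε * ((if d ∈ B then 1 else 0) - if e ∈ B then 1 else 0) := by
        intro B ε
        simp [hu, Finset.sum_add_distrib, ← Finset.mul_sum]
      simp only [hQ, Set.mem_ofPred_eq, hsum]
      refine Filter.Eventually.and (Filter.eventually_all.2 fun a => ?_)
        (Filter.eventually_all.2 fun B => ?_)
      · by_cases ha : ∀ z : ℤ, h a ≠ z
        · have h1 : (⌊x a⌋ : ℝ) < h a := lt_of_le_of_ne (hhQ.1 a).1 (ha _).symm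
          have h2 : h a < (⌈x a⌉ : ℝ) := lt_of_le_of_ne (hhQ.1 a).2 (ha _)
          have hc : ContinuousAt (fun ε : ℝ => (h + ε • u) a) 0 := by
            simp only [Pi.add_apply, Pi.smul_apply]
            fun_prop
          exact hc.eventually_mem (Icc_mem_nhds (by simpa using h1) (by simpa using h2))
        · have had : a ≠ d := by rintro rfl; exact ha hd
          have hae : a ≠ e := by rintro rfl; exact ha he
          exact Filter.Eventually.of_forall fun ε => by simpa [hu, had, hae] using hhQ.1 a
      · by_cases hB : ∑ a ∈ B, h a = w B
        · have hiff : d ∈ B ↔ e ∈ B :=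
            ⟨fun hdB => hmem d hdM hd B hB hdB heM, fun heB => hmem e heM he B hB heB hdM⟩
          exact Filter.Eventually.of_forall fun ε => by simp [hiff, hB]
        · have h1 : w B < ∑ a ∈ B, h a := lt_of_le_of_ne (hhQ.2 B).1 (Ne.symm hB)
          have hc : ContinuousAt (fun ε : ℝ => ∑ a ∈ B, h a +
            ε * ((if d ∈ B then 1 else 0) - if e ∈ B then 1 else 0)) 0 := by fun_prop
          filter_upwards [hc.eventually_mem (Ici_mem_nhds (a := w B) (by simpa using h1))]
            with ε hε
          exact ⟨hε, fun hx => absurd ((hhQ.2 B).2 hx) hB⟩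
    obtain ⟨δ, hδ, hball⟩ := Metric.eventually_nhds_iff.1 hev
    have h1 := hball (y := δ / 2) (by simp [abs_of_pos hδ]; linarith)
    have h2 := hball (y := -(δ / 2)) (by simp [abs_of_pos hδ]; linarith)
    have h3 := hh.2 h1 h2
      ⟨1 / 2, 1 / 2, by norm_num, by norm_num, by norm_num, by ext a; simp; ring⟩
    have h4 := congrFun h3 d
    simp [hu, hed.symm] at h4
    linarith
  refine ⟨h, hinteg, fun B => (hhQ.2 B).1, fun d => ?_, fun B => (hhQ.2 B).2⟩
  obtain ⟨z, hz⟩ := hinteg d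
  have h1 := hhQ.1 d
  rw [hz, Set.mem_Icc, Int.cast_le, Int.cast_le] at h1
  have h2 := Int.ceil_le_floor_add_one (x d)
  rw [hz, Int.cast_inj, Int.cast_inj]
  omega

/-- An integral vector below a capacity vector and a submodular function attains the min-max
value. -/
theorem exists_integral_maximal_of_submodular {D : Type*} [Fintype D] [DecidableEq D]
    (μ : Finset D → ℕ) (h0 : μ ∅ = 0) (hsub : ∀ A B, μ (A ∪ B) + μ (A ∩ B) ≤ μ A + μ B)
    (b : D → ℕ) :
    ∃ x : D → ℕ, x ≤ b ∧ (∀ C, ∑ d ∈ C, x d ≤ μ C) ∧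
      ∃ C, ∑ d, x d = ∑ d ∈ Cᶜ, b d + μ C := by
  have hfin : {x : D → ℕ | x ≤ b ∧ ∀ C, ∑ d ∈ C, x d ≤ μ C}.Finite :=
    (Set.finite_Iic b).subset fun x hx => hx.1
  obtain ⟨x, ⟨hxb, hxμ⟩, hmax⟩ :=
    Set.exists_max_image _ (fun x : D → ℕ => ∑ d, x d) hfin ⟨0, fun d => by simp, by simp⟩
  refine ⟨x, hxb, hxμ, ?_⟩
  -- A largest tight set `C` is the witness. If `x d < b d` outside `C`, maximality of `x` puts `d`
  -- in a tight set, whose union with `C` is tight and larger.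
  obtain ⟨C, hC, hCmax⟩ := Finset.exists_max_image
    (Finset.univ.filter fun C : Finset D => ∑ d ∈ C, x d = μ C) Finset.card
    ⟨∅, by simp [h0]⟩
  simp only [Finset.mem_filter, Finset.mem_univ, true_and] at hC hCmax
  refine ⟨C, ?_⟩
  have hsat : ∀ d ∈ Cᶜ, x d = b d := by
    intro d hd
    by_contra hne
    have hlt : x d < b d := lt_of_le_of_ne (hxb d) hne
    have hsum : ∀ B : Finset D,
        ∑ a ∈ B, (x + Pi.single d 1 : D → ℕ) a = ∑ a ∈ B, x a + if d ∈ B then 1 else 0 := by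
      intro B
      simp [Finset.sum_add_distrib]
    obtain ⟨B, hdB, hB⟩ : ∃ B, d ∈ B ∧ ∑ a ∈ B, x a = μ B := by
      by_contra! hcon
      have := hmax (x + Pi.single d 1) ⟨fun a => ?_, fun B => ?_⟩
      · simp only [hsum] at this
        simp at this
      · by_cases had : a = d
        · subst had; simpa using hlt
        · simpa [had] using hxb a
      · rw [hsum]
        have h1 := hcon B
        have h2 := hxμ B
        split_ifs with hd
        · have := h1 hd
          omega
        · omega
    have h1 := hsub C B
    have h2 := hxμ (C ∪ B)
    have h3 := hxμ (C ∩ B)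
    have h4 := Finset.sum_union_inter (s₁ := C) (s₂ := B) (f := x)
    have h5 := hCmax (C ∪ B) (by omega)
    have h6 := Finset.eq_of_subset_of_card_le Finset.subset_union_left h5
    rw [Finset.mem_compl, h6] at hd
    exact hd (Finset.mem_union_right _ hdB)
  rw [← Finset.sum_congr rfl hsat, ← hC, Finset.sum_compl_add_sum]

/-- A sum over a subtype is a sum over the whole type, with zero off the subtype. -/
theorem Fintype.sum_subtype_eq_sum_dite {ι : Type*} [Fintype ι] (p : ι → Prop) [DecidablePred p]
    [Fintype {i // p i}] (F : ∀ i, p i → ℝ) :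
    ∑ i : {i // p i}, F i.1 i.2 = ∑ i, if h : p i then F i h else 0 := by
  rw [← Finset.sum_filter_add_sum_filter_not Finset.univ p,
    Finset.sum_eq_zero (s := {i | ¬ p i}), add_zero,
    Finset.sum_subtype (p := p) (s := {i | p i}) (by simp)]
  · exact Finset.sum_congr rfl fun i _ => by rw [dif_pos i.2]
  · intro i hi
    rw [dif_neg (Finset.mem_filter.1 hi).2]

/-! ### Teacher supply, Hall's theorem and integral flows -/

namespace TransferProblem

section
variable {S D T : Type*} [Fintype S] [Fintype D] [Fintype T]

open scoped Classical in
/-- The teachers that accept some school in `B`. -/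
noncomputable def acceptors (G : TransferProblem S D T) (B : Finset D) : Finset T :=
  {t | ∃ d ∈ B, d ∈ G.A t}

open scoped Classical in
/-- The largest number of teachers that can be released to schools in `B`. -/
noncomputable def supply (G : TransferProblem S D T) (B : Finset D) : ℕ :=
  ∑ s, min (Finset.card {t ∈ G.acceptors B | G.O t = s}) (G.α s)

theorem supply_empty (G : TransferProblem S D T) : G.supply ∅ = 0 := by
  simp [supply, acceptors]

open scoped Classical in
theorem supply_mono (G : TransferProblem S D T) {A B : Finset D} (h : A ⊆ B) :
    G.supply A ≤ G.supply B := by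
  refine Finset.sum_le_sum fun s _ => min_le_min_right _ (Finset.card_le_card ?_)
  refine Finset.filter_subset_filter _ fun t ht => ?_
  simp only [acceptors, Finset.mem_filter, Finset.mem_univ, true_and] at ht ⊢
  obtain ⟨d, hd, hdt⟩ := ht
  exact ⟨d, h hd, hdt⟩

-- For each surplus school, the number of acceptors is a monotone submodular coverage function, and
-- truncation at `α s` preserves submodularity.
open scoped Classical in
theorem supply_submodular (G : TransferProblem S D T) (A B : Finset D) :
    G.supply (A ∪ B) + G.supply (A ∩ B) ≤ G.supply A + G.supply B := by
  simp only [supply, ← Finset.sum_add_distrib]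
  refine Finset.sum_le_sum fun s _ => ?_
  have hU : ({t ∈ G.acceptors (A ∪ B) | G.O t = s} : Finset T) =
      {t ∈ G.acceptors A | G.O t = s} ∪ {t ∈ G.acceptors B | G.O t = s} := by
    ext t; simp only [acceptors, Finset.mem_filter, Finset.mem_univ, Finset.mem_union, true_and]
    grind
  have hI : ({t ∈ G.acceptors (A ∩ B) | G.O t = s} : Finset T) ⊆
      {t ∈ G.acceptors A | G.O t = s} ∩ {t ∈ G.acceptors B | G.O t = s} := by
    intro t; simp only [acceptors, Finset.mem_filter, Finset.mem_univ, Finset.mem_inter, true_and]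
    grind
  have h1 := Finset.card_le_card hI
  have h2 := Finset.card_union_add_card_inter
    ({t ∈ G.acceptors A | G.O t = s} : Finset T) {t ∈ G.acceptors B | G.O t = s}
  have h3 := Finset.card_le_card (Finset.inter_subset_left
    (s₁ := ({t ∈ G.acceptors A | G.O t = s} : Finset T)) (s₂ := {t ∈ G.acceptors B | G.O t = s}))
  have h4 := Finset.card_le_card (Finset.inter_subset_right
    (s₁ := ({t ∈ G.acceptors A | G.O t = s} : Finset T)) (s₂ := {t ∈ G.acceptors B | G.O t = s}))
  rw [hU]
  omega

-- Flow into `B` passes only through acceptors of `B`. Grouped by initial school, it is bounded by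
-- their number and by `α s`.
open scoped Classical in
theorem IsFlow.sum_inflow_le_supply {G : TransferProblem S D T} {f : G.Edge → ℝ}
    (hf : G.IsFlow f) (B : Finset D) : ∑ d ∈ B, G.inflow f d ≤ G.supply B := by
  set F : T → D → ℝ := fun t d => if h : d ∈ G.A t then f (.move t d h) else 0 with hF
  have hF0 : ∀ t d, 0 ≤ F t d := fun t d => by
    simp only [hF]; split_ifs with h
    · exact hf.nonneg _
    · rfl
  have h1 : ∀ d, G.inflow f d = ∑ t, F t d := fun d =>
    Fintype.sum_subtype_eq_sum_dite (fun t => d ∈ G.A t) fun t h => f (.move t d h)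
  have h2 : ∀ t, f (.assign t) = ∑ d, F t d := fun t =>
    (hf.balance_teacher t).trans
      (Fintype.sum_subtype_eq_sum_dite (fun d => d ∈ G.A t) fun d h => f (.move t d h))
  have h3 : ∑ d ∈ B, G.inflow f d ≤ ∑ t ∈ G.acceptors B, f (.assign t) := by
    simp only [h1, h2]
    rw [Finset.sum_comm, ← Finset.sum_subset (Finset.subset_univ (G.acceptors B))]
    · exact Finset.sum_le_sum fun t _ => Finset.sum_le_sum_of_subset_of_nonneg
        (Finset.subset_univ _) fun d _ _ => hF0 t d
    · intro t _ ht
      refine Finset.sum_eq_zero fun d hd => ?_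
      simp only [acceptors, Finset.mem_filter, Finset.mem_univ, true_and, not_exists, not_and] at ht
      simp [hF, ht d hd]
  refine h3.trans ?_
  rw [← Finset.sum_fiberwise_of_maps_to (t := Finset.univ) (g := G.O) (by simp), supply]
  push_cast
  refine Finset.sum_le_sum fun s _ => le_min ?_ ?_
  · simpa using Finset.sum_le_card_nsmul {t ∈ G.acceptors B | G.O t = s} (fun t => f (.assign t)) 1
      fun t _ => hf.cap_assign t
  · refine le_trans ?_ (hf.cap_source s)
    rw [hf.balance_school]
    exact Finset.sum_le_sum_of_subset_of_nonneg
      (Finset.filter_subset_filter _ (Finset.subset_univ _)) fun t _ _ => hf.nonneg _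

open scoped Classical in
/-- Rado's theorem for the transfer problem. -/
theorem exists_assignment (G : TransferProblem S D T) (x : D → ℕ)
    (hx : ∀ B, ∑ d ∈ B, x d ≤ G.supply B) :
    ∃ g : T → Option D, (∀ t d, g t = some d → d ∈ G.A t) ∧
      (∀ d, Finset.card {t | g t = some d} = x d) ∧
      ∀ s, Finset.card {t | G.O t = s ∧ g t ≠ none} ≤ G.α s := by
  let n : S → ℕ := fun s => Finset.card {t | G.O t = s}
  -- Besides `x d` slots for each `d`, every `s` gets `n s - α s` (truncated) dummy slots that hold
  -- back its excess teachers. This encodes the source capacities in Hall's condition.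
  let N : (Σ d, Fin (x d)) ⊕ (Σ s, Fin (n s - G.α s)) → Finset T :=
    Sum.elim (fun p => Finset.univ.filter fun t => p.1 ∈ G.A t)
      (fun p => Finset.univ.filter fun t => G.O t = p.1)
  have hall : ∀ J : Finset _, J.card ≤ (J.biUnion N).card := by
    intro J
    let B : Finset D := J.toLeft.image Sigma.fst
    let S' : Finset S := J.toRight.image Sigma.fst
    have hJ : J.card ≤ ∑ d ∈ B, x d + ∑ s ∈ S', (n s - G.α s) := by
      rw [← Finset.card_toLeft_add_card_toRight]
      refine add_le_add ?_ ?_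
      · refine (Finset.card_le_card (t := B.sigma fun d => Finset.univ) fun p hp => ?_).trans
          (by simp)
        exact Finset.mem_sigma.2 ⟨Finset.mem_image_of_mem _ hp, Finset.mem_univ _⟩
      · refine (Finset.card_le_card (t := S'.sigma fun d => Finset.univ) fun p hp => ?_).trans
          (by simp)
        exact Finset.mem_sigma.2 ⟨Finset.mem_image_of_mem _ hp, Finset.mem_univ _⟩
    refine (hJ.trans (Nat.add_le_add_right (hx B) _)).trans ?_
    rw [Finset.card_eq_sum_card_fiberwise (f := G.O) (t := Finset.univ) (by simp), supply,
      ← Finset.sum_ite_mem_eq S', ← Finset.sum_add_distrib]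
    -- Hall's condition is checked school by school: if `J` has a dummy slot of `s`, all teachers of
    -- `s` are neighbours; otherwise the acceptors of `B` suffice.
    refine Finset.sum_le_sum fun s _ => ?_
    by_cases hs : s ∈ S'
    · have h1 : (J.biUnion N).filter (fun t => G.O t = s) =
          Finset.univ.filter fun t => G.O t = s := by
        ext t
        simp only [Finset.mem_filter, Finset.mem_univ, true_and, and_iff_right_iff_imp]
        intro ht
        obtain ⟨p, hp, hps⟩ := Finset.mem_image.1 hs
        exact Finset.mem_biUnion.2 ⟨_, Finset.mem_toRight.1 hp, by simp [N, ht, hps]⟩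
      have h2 : Finset.card {t ∈ G.acceptors B | G.O t = s} ≤ n s :=
        Finset.card_le_card (Finset.filter_subset_filter _ (Finset.subset_univ _))
      rw [h1, if_pos hs]
      change _ ≤ n s
      omega
    · rw [if_neg hs, add_zero]
      refine (min_le_left _ _).trans (Finset.card_le_card (Finset.filter_subset_filter _ ?_))
      intro t ht
      simp only [acceptors, Finset.mem_filter, Finset.mem_univ, true_and] at ht
      obtain ⟨d, hd, hdt⟩ := ht
      obtain ⟨p, hp, rfl⟩ := Finset.mem_image.1 hd
      exact Finset.mem_biUnion.2 ⟨_, Finset.mem_toLeft.1 hp, by simpa [N] using hdt⟩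
  obtain ⟨F, hFinj, hF⟩ := (Finset.all_card_le_biUnion_card_iff_exists_injective N).1 hall
  let g : T → Option D := fun t =>
    if h : ∃ p : Σ d, Fin (x d), F (.inl p) = t then some h.choose.1 else none
  have hg : ∀ t d, g t = some d ↔ ∃ i : Fin (x d), F (.inl ⟨d, i⟩) = t := by
    intro t d
    constructor
    · intro h
      simp only [g] at h
      split_ifs at h with hp
      rw [Option.some.injEq] at h
      subst h
      exact ⟨hp.choose.2, hp.choose_spec⟩
    · rintro ⟨i, hi⟩
      have hp : ∃ p : Σ d, Fin (x d), F (.inl p) = t := ⟨_, hi⟩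
      have : hp.choose = ⟨d, i⟩ := Sum.inl_injective (hFinj (hp.choose_spec.trans hi.symm))
      simp only [g, dif_pos hp, this]
  refine ⟨g, fun t d h => ?_, fun d => ?_, fun s => ?_⟩
  · obtain ⟨i, rfl⟩ := (hg t d).1 h
    simpa [N] using hF (.inl ⟨d, i⟩)
  · have : ({t | g t = some d} : Finset T) =
        Finset.univ.image fun i : Fin (x d) => F (.inl ⟨d, i⟩) := by
      ext t; simp [hg]
    rw [this, Finset.card_image_of_injective, Finset.card_univ, Fintype.card_fin]
    intro i j hij
    simpa using hFinj hij
  · have h1 : (Finset.univ.image fun i : Fin (n s - G.α s) => F (.inr ⟨s, i⟩)).card =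
        n s - G.α s := by
      rw [Finset.card_image_of_injective, Finset.card_univ, Fintype.card_fin]
      intro i j hij
      simpa using hFinj hij
    have h2 : Disjoint ({t | G.O t = s ∧ g t ≠ none} : Finset T)
        (Finset.univ.image fun i : Fin (n s - G.α s) => F (.inr ⟨s, i⟩)) := by
      rw [Finset.disjoint_left]
      intro t ht ht'
      simp only [Finset.mem_filter, Finset.mem_univ, true_and, Finset.mem_image] at ht ht'
      obtain ⟨d, hd⟩ := Option.ne_none_iff_exists'.1 ht.2
      obtain ⟨i, hi⟩ := (hg t d).1 hd
      obtain ⟨j, hj⟩ := ht'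
      simpa using hFinj (hi.trans hj.symm)
    have h3 := Finset.card_union_of_disjoint h2
    have h4 : ({t | G.O t = s ∧ g t ≠ none} : Finset T) ∪
        (Finset.univ.image fun i : Fin (n s - G.α s) => F (.inr ⟨s, i⟩)) ⊆
          Finset.univ.filter fun t => G.O t = s := by
      intro t ht
      simp only [Finset.mem_union, Finset.mem_filter, Finset.mem_univ, true_and,
        Finset.mem_image] at ht ⊢
      rcases ht with ht | ⟨j, rfl⟩
      · exact ht.1
      · simpa [N] using hF (.inr ⟨s, j⟩)
    have h5 : _ ≤ n s := Finset.card_le_card h4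
    omega

open scoped Classical in
theorem exists_flow_of_le_supply (G : TransferProblem S D T) (x : D → ℕ)
    (hx : ∀ B, ∑ d ∈ B, x d ≤ G.supply B) (hxβ : x ≤ G.β) :
    ∃ f : G.Edge → ℝ, G.IsFlow f ∧ ∀ d, G.inflow f d = x d := by
  obtain ⟨g, hgA, hgx, hgα⟩ := G.exists_assignment x hx
  let f : G.Edge → ℝ := fun e => match e with
    | .source s => (Finset.card {t | G.O t = s ∧ g t ≠ none} : ℝ)
    | .assign t => if g t ≠ none then 1 else 0
    | .move t d _ => if g t = some d then 1 else 0
  have hin : ∀ d, G.inflow f d = x d := by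
    intro d
    rw [← hgx d]
    refine (Fintype.sum_subtype_eq_sum_dite (fun t => d ∈ G.A t)
      fun t h => f (.move t d h)).trans ?_
    rw [Finset.card_filter]
    push_cast
    refine Finset.sum_congr rfl fun t _ => ?_
    by_cases h : g t = some d
    · simp [f, h, hgA t d h]
    · simp [f, h]
  refine ⟨f, ⟨?_, fun s => ?_, fun t => ?_, fun s => ?_, fun t => ?_, fun t d h => ?_,
    fun d => ?_⟩, hin⟩
  · rintro (s | t | ⟨t, d, h⟩)
    · exact Nat.cast_nonneg _
    · simp only [f]; split_ifs <;> norm_num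
    · simp only [f]; split_ifs <;> norm_num
  · simp only [f]
    rw [Finset.sum_boole, Finset.filter_filter]
  · refine Eq.trans ?_ (Fintype.sum_subtype_eq_sum_dite (fun d => d ∈ G.A t)
      fun d h => f (.move t d h)).symm
    rcases hgt : g t with _ | d
    · simp [f, hgt]
    · rw [Finset.sum_eq_single d]
      · simp [f, hgt, hgA t d hgt]
      · intro d' _ hd'
        simp [f, hgt, hd'.symm]
      · simp
  · exact Nat.cast_le.2 (hgα s)
  · simp only [f]; split_ifs <;> norm_num
  · simp only [f]; split_ifs <;> norm_num
  · rw [hin]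
    exact Nat.cast_le.2 (hxβ d)

end
end TransferProblem

/-! ### Min-max formula and the core of `w` -/

namespace TransferProblem

section
variable {S D T : Type*} [Fintype S] [Fintype D] [Fintype T]

open scoped Classical in
theorem v_le (G : TransferProblem S D T) {B C : Finset D} (hC : C ⊆ B) :
    G.v B ≤ ((∑ d ∈ B \ C, G.β d + G.supply C : ℕ) : ℝ) := by
  refine csSup_le (G.v_set_nonempty_bddAbove B).1 ?_
  rintro _ ⟨f, hf, rfl⟩
  rw [← Finset.sum_sdiff hC]
  push_cast
  exact add_le_add (Finset.sum_le_sum fun d _ => hf.cap_sink d) (hf.sum_inflow_le_supply _)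

open scoped Classical in
/-- The min-max formula for `v`, with an integral maximizer. -/
theorem exists_v_eq (G : TransferProblem S D T) (B : Finset D) :
    ∃ C ⊆ B, G.v B = ((∑ d ∈ B \ C, G.β d + G.supply C : ℕ) : ℝ) := by
  -- Zero capacity off `B` confines `x` to `B`. The set `C` may leave `B`, but `B ∩ C` gives no
  -- larger a bound because `supply` is monotone.
  obtain ⟨x, hxb, hxs, C, hC⟩ := exists_integral_maximal_of_submodular G.supply G.supply_empty
    G.supply_submodular (fun d => if d ∈ B then G.β d else 0)
  have hxβ : x ≤ G.β := fun d => (hxb d).trans (by dsimp only; split_ifs <;> simp)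
  obtain ⟨f, hf, hfx⟩ := G.exists_flow_of_le_supply x hxs hxβ
  have hCv : ∑ d ∈ B, x d = ∑ d ∈ B \ C, G.β d + G.supply C := by
    have h1 : ∑ d ∈ B, x d = ∑ d, x d := Finset.sum_subset (Finset.subset_univ _) fun d _ hd => by
      simpa [hd] using hxb d
    rw [h1, hC, ← Finset.sum_filter]
    congr 2
    ext d
    simp [and_comm]
  have hge : ((∑ d ∈ B, x d : ℕ) : ℝ) ≤ G.v B :=
    le_csSup (G.v_set_nonempty_bddAbove B).2 ⟨f, hf, by simp [hfx]⟩
  refine ⟨B ∩ C, Finset.inter_subset_left,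
    (G.v_le Finset.inter_subset_left).antisymm (le_trans ?_ hge)⟩
  rw [hCv, Finset.sdiff_inter_self_left]
  exact Nat.cast_le.2 (Nat.add_le_add_left (G.supply_mono Finset.inter_subset_right) _)

-- The union and intersection of optimal cuts for `A` and `B` are cuts for `A ∪ B` and `A ∩ B`; `β`
-- is modular and `supply` submodular.
open scoped Classical in
theorem v_submodular (G : TransferProblem S D T) (A B : Finset D) :
    G.v (A ∪ B) + G.v (A ∩ B) ≤ G.v A + G.v B := by
  obtain ⟨A', hA', hA⟩ := G.exists_v_eq A
  obtain ⟨B', hB', hB⟩ := G.exists_v_eq B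
  refine (add_le_add (G.v_le (Finset.union_subset_union hA' hB'))
    (G.v_le (Finset.inter_subset_inter hA' hB'))).trans ?_
  rw [hA, hB]
  norm_cast
  have h1 := G.supply_submodular A' B'
  have h2 := Finset.sum_sdiff (f := G.β) hA'
  have h3 := Finset.sum_sdiff (f := G.β) hB'
  have h4 := Finset.sum_sdiff (f := G.β) (Finset.union_subset_union hA' hB')
  have h5 := Finset.sum_sdiff (f := G.β) (Finset.inter_subset_inter hA' hB')
  have h6 := Finset.sum_union_inter (s₁ := A) (s₂ := B) (f := G.β)
  have h7 := Finset.sum_union_inter (s₁ := A') (s₂ := B') (f := G.β)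
  omega

open scoped Classical in
theorem w_supermodular (G : TransferProblem S D T) (A B : Finset D) :
    G.w A + G.w B ≤ G.w (A ∪ B) + G.w (A ∩ B) := by
  have h1 := G.v_submodular A B
  have h2 := Finset.sum_union_inter (s₁ := A) (s₂ := B) (f := fun d => (G.β d : ℝ))
  simp only [w]
  linarith

open scoped Classical in
theorem w_integral (G : TransferProblem S D T) (B : Finset D) : ∃ z : ℤ, G.w B = z := by
  obtain ⟨C, -, hC⟩ := G.exists_v_eq B
  exact ⟨∑ d ∈ B, (G.β d : ℤ) - (∑ d ∈ B \ C, G.β d + G.supply C : ℕ), by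
    rw [w, hC]; push_cast; rfl⟩

theorem w_empty (G : TransferProblem S D T) : G.w ∅ = 0 := by
  obtain ⟨C, hC, hv⟩ := G.exists_v_eq ∅
  rw [Finset.subset_empty] at hC
  subst hC
  simp [w, hv, supply_empty]

open scoped Classical in
theorem v_mono (G : TransferProblem S D T) {A B : Finset D} (h : A ⊆ B) : G.v A ≤ G.v B := by
  refine csSup_le (G.v_set_nonempty_bddAbove A).1 ?_
  rintro _ ⟨f, hf, rfl⟩
  refine le_csSup_of_le (G.v_set_nonempty_bddAbove B).2 ⟨f, hf, rfl⟩ ?_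
  exact Finset.sum_le_sum_of_subset_of_nonneg h fun d _ _ =>
    Finset.sum_nonneg fun t _ => hf.nonneg _

open scoped Classical in
/-- Integral vectors in the core of `w` are achievable. -/
theorem achievable_of_core (G : TransferProblem S D T) (h : D → ℝ)
    (hint : ∀ d, ∃ z : ℤ, h d = z) (hge : ∀ B, G.w B ≤ ∑ d ∈ B, h d)
    (htop : ∑ d, h d = G.w Finset.univ) : G.Achievable h := by
  choose z hz using hint
  have hv : ∀ B, ∑ d ∈ B, ((G.β d : ℝ) - h d) ≤ G.v B := fun B => by
    have := hge B
    rw [w] at this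
    rw [Finset.sum_sub_distrib]
    linarith
  -- The core conditions on `D` and `D \ {d}` bound `h d` by the marginal `w(D) - w(D \ {d})`, which
  -- is at most `β d` as `v` is monotone.
  have hle : ∀ d, h d ≤ G.β d := fun d => by
    have h1 := Finset.sum_erase_add Finset.univ h (Finset.mem_univ d)
    have h2 := Finset.sum_erase_add Finset.univ (fun d => (G.β d : ℝ)) (Finset.mem_univ d)
    have h3 := hge (Finset.univ.erase d)
    have h4 := G.v_mono (Finset.subset_univ (Finset.univ.erase d))
    simp only [w] at htop h3
    linarith
  have hx : ∀ d, (((G.β d : ℤ) - z d).toNat : ℝ) = G.β d - h d := fun d => by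
    have h1 := hle d
    rw [hz] at h1 ⊢
    have h2 : (0 : ℤ) ≤ G.β d - z d := sub_nonneg.2 (by exact_mod_cast h1)
    have h3 : ((((G.β d : ℤ) - z d).toNat : ℤ) : ℝ) = (((G.β d : ℤ) - z d : ℤ) : ℝ) := by
      rw [Int.toNat_of_nonneg h2]
    push_cast at h3
    exact_mod_cast h3
  -- The cut `C = B` yields the supply bounds and `C = ∅` the sink capacities.
  obtain ⟨f, hf, hfx⟩ := G.exists_flow_of_le_supply (fun d => ((G.β d : ℤ) - z d).toNat)
    (fun B => by
      have h1 := (hv B).trans (G.v_le (Finset.Subset.refl B))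
      simp only [← hx, Finset.sdiff_self, Finset.sum_empty, zero_add] at h1
      exact_mod_cast h1)
    (fun d => by
      have h1 := (hv {d}).trans (G.v_le (Finset.empty_subset {d}))
      simp only [← hx, supply_empty, Finset.sdiff_empty, Finset.sum_singleton, add_zero] at h1
      exact_mod_cast h1)
  exact ⟨f, hf, fun d => by rw [hfx, hx]; ring⟩

/-! ### Runs of the MDR algorithm and their output -/

theorem prefixUnion_zero {D : Type*} {k : ℕ} (P : Fin k → Finset D) : prefixUnion P 0 = ∅ := by
  simp [prefixUnion]

open scoped Classical in
theorem prefixUnion_succ {D : Type*} {k : ℕ} (P : Fin k → Finset D) (j : Fin k) :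
    prefixUnion P ((j : ℕ) + 1) = P j ∪ prefixUnion P j := by
  ext d
  simp only [prefixUnion, Finset.mem_biUnion, Finset.mem_filter, Finset.mem_univ, true_and,
    Finset.mem_union, Nat.lt_succ_iff_lt_or_eq, Fin.val_inj]
  grind

theorem prefixUnion_snoc {D : Type*} {k : ℕ} (P : Fin k → Finset D) (B : Finset D) {m : ℕ}
    (hm : m ≤ k) : prefixUnion (Fin.snoc P B : Fin (k + 1) → Finset D) m = prefixUnion P m := by
  ext d
  simp only [prefixUnion, Finset.mem_biUnion, Finset.mem_filter, Finset.mem_univ, true_and]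
  constructor
  · rintro ⟨i, hi, hd⟩
    refine ⟨⟨i, by omega⟩, hi, ?_⟩
    have : i = Fin.castSucc ⟨i, by omega⟩ := rfl
    rw [this, Fin.snoc_castSucc] at hd
    exact hd
  · rintro ⟨i, hi, hd⟩
    exact ⟨i.castSucc, hi, by rwa [Fin.snoc_castSucc]⟩

theorem exists_isMDRChoice (G : TransferProblem S D T) {C : Finset D} (hC : C ≠ Finset.univ) :
    ∃ B, G.IsMDRChoice C B := by
  classical
  obtain ⟨d, hd⟩ : ∃ d, d ∉ C := by
    by_contra! h
    exact hC (Finset.eq_univ_of_forall h)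
  obtain ⟨B, hB, hmax⟩ := Finset.exists_max_image
    (Finset.univ.filter fun B : Finset D => B.Nonempty ∧ Disjoint B C)
    (fun B => (G.w (B ∪ C) - G.w C) / (B.card : ℝ)) ⟨{d}, by simpa using hd⟩
  simp only [Finset.mem_filter, Finset.mem_univ, true_and] at hB hmax
  refine ⟨B, hB.1, hB.2, fun B' h1 h2 => ?_⟩
  convert hmax B' ⟨h1, h2⟩

open scoped Classical in
theorem exists_MDR_run (G : TransferProblem S D T) : ∃ (k : ℕ) (P : Fin k → Finset D),
    (∀ j : Fin k, G.IsMDRChoice (prefixUnion P j) (P j)) ∧ prefixUnion P k = Finset.univ := by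
  -- Each chosen block adds at least one new school, so a run that has not exhausted `D` can be
  -- extended until its prefix would outgrow `D`.
  have key : ∀ n : ℕ, ∃ (k : ℕ) (P : Fin k → Finset D),
      (∀ j : Fin k, G.IsMDRChoice (prefixUnion P j) (P j)) ∧
      (prefixUnion P k = Finset.univ ∨ n ≤ (prefixUnion P k).card) := by
    intro n
    induction n with
    | zero => exact ⟨0, Fin.elim0, fun j => j.elim0, Or.inr (Nat.zero_le _)⟩
    | succ n ih =>
      obtain ⟨k, P, hP, hk⟩ := ih
      by_cases hu : prefixUnion P k = Finset.univ
      · exact ⟨k, P, hP, Or.inl hu⟩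
      obtain ⟨B, hB⟩ := G.exists_isMDRChoice hu
      refine ⟨k + 1, Fin.snoc P B, fun j => ?_, Or.inr ?_⟩
      · rw [prefixUnion_snoc P B (Nat.lt_succ_iff.1 j.2)]
        induction j using Fin.lastCases with
        | last => simpa using hB
        | cast j => simpa using hP j
      · have h1 := prefixUnion_succ (Fin.snoc P B : Fin (k + 1) → Finset D) (Fin.last k)
        rw [Fin.val_last, Fin.snoc_last, prefixUnion_snoc P B le_rfl] at h1
        rw [h1, Finset.card_union_of_disjoint hB.2.1]
        have := hB.1.card_pos
        have := hk.resolve_left hu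
        omega
  obtain ⟨k, P, hP, hk⟩ := key (Fintype.card D + 1)
  refine ⟨k, P, hP, hk.resolve_right fun h => ?_⟩
  have := Finset.card_le_univ (prefixUnion P k)
  omega

open scoped Classical in
theorem exists_isMDROutput (G : TransferProblem S D T) :
    ∃ (k : ℕ) (P : Fin k → Finset D) (hstar : D → ℝ), G.IsMDROutput P hstar := by
  obtain ⟨k, P, hP, hk⟩ := G.exists_MDR_run
  have hex : ∀ d, ∃ j, d ∈ P j := fun d => by
    have : d ∈ prefixUnion P k := hk ▸ Finset.mem_univ d
    obtain ⟨j, -, hj⟩ := Finset.mem_biUnion.1 this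
    exact ⟨j, hj⟩
  choose J hJ using hex
  -- The blocks are disjoint, so the value at `d` does not depend on the chosen index.
  have hlt : ∀ (d : D) (i j : Fin k), i < j → d ∈ P i → d ∉ P j := fun d i j hij hi hj =>
    Finset.disjoint_left.1 (hP j).2.1 hj (Finset.mem_biUnion.2 ⟨i, by simpa using hij, hi⟩)
  refine ⟨k, P, fun d => (G.w (prefixUnion P ((J d : ℕ) + 1)) - G.w (prefixUnion P (J d))) /
    ((P (J d)).card : ℝ), hP, hk, fun j d hd => ?_⟩
  have : J d = j := by
    rcases lt_trichotomy (J d) j with h | h | h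
    · exact absurd hd (hlt d _ _ h (hJ d))
    · exact h
    · exact absurd (hJ d) (hlt d _ _ h hd)
  rw [this]

section
variable {G : TransferProblem S D T} {k : ℕ} {P : Fin k → Finset D} {hstar : D → ℝ}

-- The values on a block add up to its marginal contribution, and these telescope from `w ∅ = 0`.
open scoped Classical in
theorem IsMDROutput.sum_prefixUnion (hG : G.IsMDROutput P hstar) (m : ℕ) (hm : m ≤ k) :
    ∑ d ∈ prefixUnion P m, hstar d = G.w (prefixUnion P m) := by
  induction m with
  | zero => simp [prefixUnion_zero, w_empty]
  | succ m ih =>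
    have hs := prefixUnion_succ P ⟨m, hm⟩
    have hc := hG.choice ⟨m, hm⟩
    have hcard : ((P ⟨m, hm⟩).card : ℝ) ≠ 0 := by exact_mod_cast hc.1.card_pos.ne'
    have hval := Finset.sum_congr rfl (hG.value ⟨m, hm⟩)
    simp only [Finset.sum_const, nsmul_eq_mul, mul_div_cancel₀ _ hcard] at hs hc hval
    rw [hs, Finset.sum_union hc.2.1, ih (by omega), hval, hs]
    ring

-- Induction on prefixes `U`, with next block `R`: by supermodularity, adding `B ∩ R` to `B ∩ U`
-- raises `w` by at most `w((B ∩ R) ∪ U) - w(U)`. Since `R` maximizes the average, this is at most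
-- `hstar(B ∩ R)`.
open scoped Classical in
theorem IsMDROutput.w_le_sum (hG : G.IsMDROutput P hstar) (B : Finset D) :
    G.w B ≤ ∑ d ∈ B, hstar d := by
  have key : ∀ m ≤ k, G.w (B ∩ prefixUnion P m) ≤ ∑ d ∈ B ∩ prefixUnion P m, hstar d := by
    intro m hm
    induction m with
    | zero => simp [prefixUnion_zero, w_empty]
    | succ m ih =>
      have ih := ih (by omega)
      have hs := prefixUnion_succ P ⟨m, hm⟩
      obtain ⟨hne, hdisj, hmax⟩ := hG.choice ⟨m, hm⟩
      have hval := hG.value ⟨m, hm⟩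
      simp only at hs hdisj hmax hval
      set R := P ⟨m, hm⟩
      set U := prefixUnion P m
      have hd' : Disjoint (B ∩ R) U := hdisj.mono_left Finset.inter_subset_right
      have hsup := G.w_supermodular (B ∩ (R ∪ U)) U
      have e1 : B ∩ (R ∪ U) ∪ U = B ∩ R ∪ U := by
        ext d; simp only [Finset.mem_union, Finset.mem_inter]; tauto
      have e2 : B ∩ (R ∪ U) ∩ U = B ∩ U := by
        ext d; simp only [Finset.mem_union, Finset.mem_inter]; tauto
      rw [e1, e2] at hsup
      have hmarg : G.w (B ∩ R ∪ U) - G.w U ≤ ∑ d ∈ B ∩ R, hstar d := by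
        rcases (B ∩ R).eq_empty_or_nonempty with h0 | h0
        · simp [h0]
        · have h1 := hmax _ h0 hd'
          rw [Finset.sum_congr rfl fun d hd => hval d (Finset.mem_of_mem_inter_right hd),
            Finset.sum_const, nsmul_eq_mul, hs, mul_comm]
          exact (div_le_iff₀ (by exact_mod_cast h0.card_pos)).1 h1
      rw [hs]
      have e3 : B ∩ (R ∪ U) = B ∩ R ∪ B ∩ U := Finset.inter_union_distrib_left _ _ _
      rw [e3, Finset.sum_union (hd'.mono_right Finset.inter_subset_right), ← e3]
      linarith
  simpa [hG.exhaust] using key k le_rfl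

end

end
end TransferProblem

theorem mainTheorem2 {S D T : Type*} [Fintype S] [Fintype D] [Fintype T]
    (G : TransferProblem S D T) :
    (∃ (k : ℕ) (P : Fin k → Finset D) (hstar : D → ℝ), G.IsMDROutput P hstar) ∧
    ∀ (k : ℕ) (P : Fin k → Finset D) (hstar : D → ℝ), G.IsMDROutput P hstar →
      ∃ h : D → ℝ, G.IsMDRConsistent P hstar h := by
  classical
  refine ⟨G.exists_isMDROutput, fun k P hstar hG => ?_⟩
  have htop : ∑ d, hstar d = G.w Finset.univ := by
    simpa only [hG.exhaust] using hG.sum_prefixUnion k le_rfl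
  obtain ⟨h, hint, hge, hround, htight⟩ := exists_integral_rounding G.w G.w_integral
    (fun A B => by convert G.w_supermodular A B) hstar hG.w_le_sum htop
  exact ⟨h, hint, G.achievable_of_core h hint hge (htight _ htop), hround,
    fun j => htight _ (hG.sum_prefixUnion _ j.2)⟩
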